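/- Let $\mathcal{P}$ be a finite set of secrets, partitioned into non-empty classes $\mathcal{E}_1,\dots,\mathcal{E}_N$ ($N\ge 1$) with usability costs $0\le C_1<\dots<C_N$; write $c(d)=C_i$ for $d\in\mathcal{E}_i$. Let $\sigma,\lambda>0$ and $\gamma>\sigma$. In the Costly-Guesses game the picker chooses a secret $d\in\mathcal{P}$, and the guesser chooses a finite sequence $A$ of distinct secrets (possibly empty, meaning that he quits at once). With $\mathrm{pos}_A(d)$ the position of $d$ in $A$ if $d\in A$, and the length of $A$ otherwise, the utilities of the picker and the guesser are $$u_D(d,A)=-c(d)-\lambda\mathbf{1}[d\in A],\qquad u_A(d,A)=\gamma\mathbf{1}[d\in A]-\sigma\,\mathrm{pos}_A(d),$$ extended to independent mixed strategies $\delta,\alpha$ by expectation. A Strong Stackelberg Equilibrium (SSE) is a pair $(\delta^*,\alpha^{\mathrm{BR}})$ of a mixed strategy of the picker and a map from mixed strategies of the picker to mixed strategies of the guesser such that, for every $\delta$, $\alpha^{\mathrm{BR}}(\delta)$ maximizes $u_A(\delta,\cdot)$ and, among the maximizers, maximizes $u_D(\delta,\cdot)$, and such that $\delta^*$ maximizes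 $u_D(\delta,\alpha^{\mathrm{BR}}(\delta))$ over all $\delta$. An SSE strategy of the picker is the first component $\delta^*$ of some SSE. Consider the linear program $$u_D^*=\max_{\nu}\Big[-\sum_{i=1}^N C_i\nu_i\Big]$$ subject to $$\nu_i\ge 0\ (1\le i\le N),\qquad \sum_{i=1}^N\nu_i=1,\qquad \frac{\nu_i}{|\mathcal{E}_i|}\ge\frac{\nu_{i+1}}{|\mathcal{E}_{i+1}|}\ (1\le i\le N-1),$$ $$\gamma\sum_{i=1}^K\nu_i-\sigma\sum_{i=1}^K\Big[|\mathcal{E}_i|\Big(1-\sum_{j=1}^{i-1}\nu_j\Big)-\frac{|\mathcal{E}_i|-1}{2}\nu_i\Big]\le 0\quad(1\le K\le N).$$ 1. If $(|\mathcal{P}|+1)\sigma/2>\gamma$, then the linear program is feasible and its maximum is attained. Let $\nu^*$ be any solution. - (a) If $u_D^*>-C_1-\lambda$, then $\delta(p)=\nu_i^*/|\mathcal{E}_i|$ for $p\in\mathcal{E}_i$ defines an SSE strategy of the picker, and the picker's expected utility in every SSE is $u_D^*$. - (b) If $u_D^*<-C_1-\lambda$, then choosing from the cheapest class is the SSE strategy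 of the picker: a mixed strategy $\delta$ is an SSE strategy if and only if $\delta(\mathcal{E}_1)=1$. The picker's expected utility in every SSE is $-C_1-\lambda$, and for every $\delta$ with $\delta(\mathcal{E}_1)=1$, every sequence used with positive probability in a best response of the guesser to $\delta$ is non-empty and contains every secret of positive $\delta$-probability, so that the secret is found with probability one. 2. If $(|\mathcal{P}|+1)\sigma/2<\gamma$, then the conclusions of 1(b) hold. -/

import Mathlib

/-- The set `Ψ(P)` of pure strategies of the guesser: finite sequences of secrets without
repetition. The empty sequence means quitting before the first guess. -/
abbrev GuessSeq (P : Type*) : Type _ := {l : List P // l.Nodup}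

/-- The probability distributions `Δ(S)` over a finite set `S`, as functions `S → ℝ`
(read `δ.1 s` for the probability of `s`). -/
abbrev MixedStrategy (S : Type*) [Fintype S] : Type _ := ↥(stdSimplex ℝ S)

/-- The data of a Costly-Guesses game: a finite set `P` of secrets, partitioned into the nonempty
cost classes `E 0, …, E (N - 1)`, the usability costs `0 ≤ C 0 < ⋯ < C (N - 1)` of these classes,
the cost `σ` of a guess, the gain `γ` of the guesser and the loss `lam` of the picker when the
secret is found. -/
structure CostlyGuessesGame (P : Type*) [Fintype P] [DecidableEq P] (N : ℕ) [NeZero N] where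
  E : Fin N → Finset P
  E_nonempty : ∀ i, (E i).Nonempty
  E_disjoint : ∀ i j, i ≠ j → Disjoint (E i) (E j)
  E_cover : ∀ p, ∃ i, p ∈ E i
  C : Fin N → ℝ
  C_nonneg : 0 ≤ C 0
  C_strictMono : StrictMono C
  σ : ℝ
  σ_pos : 0 < σ
  γ : ℝ
  γ_pos : 0 < γ
  lam : ℝ
  lam_pos : 0 < lam

/-- The position (counted from `1`) of `d` in the sequence `A` if `d` occurs in `A`, and the length
of `A` otherwise: the number of guesses made when the secret is `d`. -/
def guessPos {P : Type*} [DecidableEq P] (A : GuessSeq P) (d : P) : ℕ :=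
  if d ∈ A.1 then A.1.idxOf d + 1 else A.1.length

namespace CostlyGuessesGame

noncomputable section

variable {P : Type*} [Fintype P] [DecidableEq P] {N : ℕ} [NeZero N]

/-- The usability cost `c(d) = ∑ᵢ Cᵢ 1_{Eᵢ}(d)` of the secret `d`. -/
def cost (G : CostlyGuessesGame P N) (d : P) : ℝ :=
  ∑ i, if d ∈ G.E i then G.C i else 0

/-- The picker's utility `u_D(d, A)` for a pure profile. -/
def uD (G : CostlyGuessesGame P N) (d : P) (A : GuessSeq P) : ℝ :=
  -G.cost d - G.lam * (if d ∈ A.1 then 1 else 0)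

/-- The guesser's utility `u_A(d, A)` for a pure profile. -/
def uA (G : CostlyGuessesGame P N) (d : P) (A : GuessSeq P) : ℝ :=
  G.γ * (if d ∈ A.1 then 1 else 0) - G.σ * (guessPos A d : ℝ)

/-- The picker's expected utility `u_D(δ, α)`. -/
def expUD (G : CostlyGuessesGame P N) (δ : MixedStrategy P) (α : MixedStrategy (GuessSeq P)) : ℝ :=
  ∑ d, ∑ A, G.uD d A * δ.1 d * α.1 A

/-- The guesser's expected utility `u_A(δ, α)`. -/
def expUA (G : CostlyGuessesGame P N) (δ : MixedStrategy P) (α : MixedStrategy (GuessSeq P)) : ℝ :=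
  ∑ d, ∑ A, G.uA d A * δ.1 d * α.1 A

/-- `α` is a best response of the guesser to the picker's mixed strategy `δ`. -/
def IsBestResponse (G : CostlyGuessesGame P N) (δ : MixedStrategy P)
    (α : MixedStrategy (GuessSeq P)) : Prop :=
  ∀ α', G.expUA δ α' ≤ G.expUA δ α

/-- `(δ, br)` is a Strong Stackelberg Equilibrium with the picker as leader: `δ` is an optimal
commitment against `br`, and `br` always plays a best response, ties between best responses being
broken in favour of the picker. -/
structure IsSSE (G : CostlyGuessesGame P N) (δ : MixedStrategy P)
    (br : MixedStrategy P → MixedStrategy (GuessSeq P)) : Prop where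
  leader_optimal : ∀ δ', G.expUD δ' (br δ') ≤ G.expUD δ (br δ)
  best_response : ∀ δ', G.IsBestResponse δ' (br δ')
  ties_for_leader : ∀ δ' α, G.IsBestResponse δ' α → G.expUD δ' α ≤ G.expUD δ' (br δ')

/-- `δ` is a Strong Stackelberg Equilibrium strategy of the picker. -/
def IsSSEStrategy (G : CostlyGuessesGame P N) (δ : MixedStrategy P) : Prop :=
  ∃ br, G.IsSSE δ br

/-- The constraints of the linear program in the class masses `ν`: a probability vector, densities
`νᵢ / |Eᵢ|` nonincreasing along the classes, and one deterrence inequality for each initial segment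
of classes. -/
structure LPFeasible (G : CostlyGuessesGame P N) (ν : Fin N → ℝ) : Prop where
  nonneg : ∀ i, 0 ≤ ν i
  sum_eq_one : ∑ i, ν i = 1
  density_mono : ∀ i j : Fin N, (j : ℕ) = (i : ℕ) + 1 →
    ν j / ((G.E j).card : ℝ) ≤ ν i / ((G.E i).card : ℝ)
  deterrence : ∀ K : Fin N,
    G.γ * ∑ i ∈ Finset.Iic K, ν i
      - G.σ * ∑ i ∈ Finset.Iic K,
          (((G.E i).card : ℝ) * (1 - ∑ j ∈ Finset.Iio i, ν j)
            - (((G.E i).card : ℝ) - 1) / 2 * ν i) ≤ 0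

/-- The objective `-∑ᵢ Cᵢ νᵢ` of the linear program. -/
def lpObjective (G : CostlyGuessesGame P N) (ν : Fin N → ℝ) : ℝ :=
  -∑ i, G.C i * ν i

/-- `ν` is a solution of the linear program; its optimal value is then `G.lpObjective ν`. -/
structure IsLPSolution (G : CostlyGuessesGame P N) (ν : Fin N → ℝ) : Prop where
  feasible : G.LPFeasible ν
  optimal : ∀ ν', G.LPFeasible ν' → G.lpObjective ν' ≤ G.lpObjective ν

/-- The picker's mixed strategy `δ` chooses from the cheapest class with probability one. -/
def ChoosesCheapest (G : CostlyGuessesGame P N) (δ : MixedStrategy P) : Prop :=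
  ∑ p ∈ G.E 0, δ.1 p = 1

/-- The probability that the secret is found under the mixed profile `(δ, α)`. -/
def findProb (_G : CostlyGuessesGame P N) (δ : MixedStrategy P)
    (α : MixedStrategy (GuessSeq P)) : ℝ :=
  ∑ d, ∑ A : GuessSeq P, (if d ∈ A.1 then 1 else 0) * δ.1 d * α.1 A

/-- Choosing from the cheapest class is the SSE strategy of the picker: the SSE strategies are
exactly the distributions on the cheapest class, the picker gets `-C₁ - λ` in every SSE, and every
best response of the guesser to such a distribution enters with probability one, explores all the
secrets that may have been chosen, and so finds the secret with probability one. -/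
structure CheapestIsTheSSE (G : CostlyGuessesGame P N) : Prop where
  sse_iff : ∀ δ, G.IsSSEStrategy δ ↔ G.ChoosesCheapest δ
  utility : ∀ δ br, G.IsSSE δ br → G.expUD δ (br δ) = -G.C 0 - G.lam
  explored : ∀ δ, G.ChoosesCheapest δ → ∀ α, G.IsBestResponse δ α → ∀ A : GuessSeq P,
    0 < α.1 A → A.1 ≠ [] ∧ ∀ p, 0 < δ.1 p → p ∈ A.1
  found : ∀ δ, G.ChoosesCheapest δ → ∀ α, G.IsBestResponse δ α → G.findProb δ α = 1

end

end CostlyGuessesGame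

/-! Call a distribution deterrent if no sequence of guesses has positive expected payoff against it;
quitting is then a best response. The argument reduces the game to deterrent distributions and
identifies the cheapest of these with the linear program.

Reduction. Let an optimal sequence find mass `M < 1`. The secrets left over, conditioned on not
being found, form a deterrent distribution, since a profitable continuation could be appended
(`exists_deterrent_of_unexplored`). Hence the picker gets at most `M * (-C 0 - lam) + (1 - M) * D`,
where `D` bounds his payoff from deterrent distributions (`picker_payoff_le`). Whichever of the two
values is larger decides the equilibrium: an optimal deterrent distribution
(`sse_of_optimal_deterrent`) or the cheapest class (`cheapestIsTheSSE_of_deterrent_lt`).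

Linear program. An optimal deterrent distribution gives no more mass to a secret of a dearer class,
or swapping two secrets would lower the cost. Guessing class by class, each class in the better of
an order and its reverse, earns at least the left side of the deterrence constraint, so its class
masses are feasible (`Deterrent.lpFeasible`). Conversely, spreading feasible masses uniformly over
the classes is deterrent (`LPFeasible.deterrent`): inside a class the guesser's payoff is bounded by
a convex quadratic in the number of guesses, which is nonpositive at both ends of the class.

Deterrent distributions exist when `γ < (|P| + 1) σ / 2`, the uniform one being an example, and do
not exist under the reverse strict inequality, because the full list and its reverse together earn
`2 (γ - (|P| + 1) σ / 2)`. -/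

namespace CostlyGuessesGame

/-! ### Initial segments of the classes -/

lemma sum_Iic_eq {N : ℕ} (f : Fin N → ℝ) (i : Fin N) :
    ∑ j ∈ Finset.Iic i, f j = ∑ j ∈ Finset.Iio i, f j + f i := by
  rw [← Finset.Iio_insert, Finset.sum_insert (by simp), add_comm]

lemma Iio_eq_Iic {N : ℕ} {i j : Fin N} (h : (j : ℕ) = i + 1) : Finset.Iio j = Finset.Iic i := by
  ext k
  simp only [Finset.mem_Iio, Finset.mem_Iic, Fin.lt_def, Fin.le_def]
  omega

lemma Iio_eq_empty_or {N : ℕ} (i : Fin N) :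
    Finset.Iio i = ∅ ∨ ∃ j : Fin N, (i : ℕ) = j + 1 ∧ Finset.Iio i = Finset.Iic j := by
  rcases Nat.eq_zero_or_pos (i : ℕ) with h | h
  · left
    ext k
    simp only [Finset.mem_Iio, Fin.lt_def, Finset.notMem_empty, iff_false]
    omega
  · right
    have hj : (i : ℕ) = ((⟨i - 1, by omega⟩ : Fin N) : ℕ) + 1 := by
      simp only
      omega
    exact ⟨_, hj, Iio_eq_Iic hj⟩

lemma antitone_of_adjacent {N : ℕ} {d : Fin N → ℝ}
    (h : ∀ i j : Fin N, (j : ℕ) = i + 1 → d j ≤ d i) : Antitone d := by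
  have : ∀ n (i j : Fin N), (j : ℕ) = i + n → d j ≤ d i := by
    intro n
    induction n with
    | zero => exact fun i j hij => (congrArg d (Fin.ext hij)).le
    | succ n ih =>
      intro i j hij
      have hk : (i : ℕ) + n < N := by omega
      exact (h ⟨i + n, hk⟩ j (by simp only; omega)).trans (ih i ⟨i + n, hk⟩ rfl)
  intro i j hij
  exact this (j - i) i j (by rw [Fin.le_def] at hij; omega)

noncomputable section

variable {P : Type*} [Fintype P] [DecidableEq P] {N : ℕ} [NeZero N]

/-! ### Payoff along a sequence of guesses -/

/-- The expected payoff of guessing along the list, when the secrets not yet explored have total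
mass `R` and the secret `d` has mass `δ d`. -/
def seqPay (G : CostlyGuessesGame P N) (δ : P → ℝ) : ℝ → List P → ℝ
  | _, [] => 0
  | R, a :: l => G.γ * δ a - G.σ * R + seqPay G δ (R - δ a) l

/-- The expected payoff of a pure strategy of the guesser. -/
def pay (G : CostlyGuessesGame P N) (δ : P → ℝ) (A : GuessSeq P) : ℝ :=
  ∑ d, G.uA d A * δ d

/-- Quitting at once is a best response to `δ`. -/
def Deterrent (G : CostlyGuessesGame P N) (δ : P → ℝ) : Prop :=
  ∀ A : GuessSeq P, G.pay δ A ≤ 0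

/-- The expected usability cost. -/
def expCost (G : CostlyGuessesGame P N) (δ : P → ℝ) : ℝ :=
  ∑ d, G.cost d * δ d

lemma seqPay_congr (G : CostlyGuessesGame P N) {δ δ' : P → ℝ} (R : ℝ) (l : List P)
    (h : ∀ a ∈ l, δ a = δ' a) : G.seqPay δ R l = G.seqPay δ' R l := by
  induction l generalizing R with
  | nil => rfl
  | cons a l ih =>
    simp only [seqPay]
    rw [h a (by simp), ih _ fun b hb => h b (by simp [hb])]

lemma seqPay_append (G : CostlyGuessesGame P N) (δ : P → ℝ) (R : ℝ) (l l' : List P) :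
    G.seqPay δ R (l ++ l') = G.seqPay δ R l + G.seqPay δ (R - (l.map δ).sum) l' := by
  induction l generalizing R with
  | nil => simp [seqPay]
  | cons a l ih =>
    simp only [List.cons_append, seqPay, ih, List.map_cons, List.sum_cons]
    rw [sub_add_eq_sub_sub]
    ring

lemma seqPay_sub (G : CostlyGuessesGame P N) (δ : P → ℝ) (R x : ℝ) (l : List P) :
    G.seqPay δ (R - x) l = G.seqPay δ R l + G.σ * l.length * x := by
  induction l generalizing R with
  | nil => simp [seqPay]
  | cons a l ih =>
    simp only [seqPay, List.length_cons]
    rw [sub_right_comm, ih]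
    push_cast
    ring

/-- A list and its reverse together earn twice the payoff of a uniformly random order. -/
lemma seqPay_add_reverse (G : CostlyGuessesGame P N) (δ : P → ℝ) (R : ℝ) (l : List P) :
    G.seqPay δ R l + G.seqPay δ R l.reverse =
      2 * (G.γ * (l.map δ).sum
        - G.σ * (l.length * R - ((l.length : ℝ) - 1) / 2 * (l.map δ).sum)) := by
  induction l with
  | nil => simp [seqPay]
  | cons a l ih =>
    simp only [List.reverse_cons, seqPay_append, seqPay, seqPay_sub, List.map_reverse,
      List.sum_reverse, List.map_cons, List.sum_cons, List.length_cons]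
    push_cast
    linarith

lemma seqPay_map (G : CostlyGuessesGame P N) (δ : P → ℝ) (R : ℝ) (f : P → P) (l : List P) :
    G.seqPay (δ ∘ f) R l = G.seqPay δ R (l.map f) := by
  induction l generalizing R with
  | nil => rfl
  | cons a l ih => simp [seqPay, ih]

lemma seqPay_smul (G : CostlyGuessesGame P N) (δ : P → ℝ) (R c : ℝ) (l : List P) :
    G.seqPay (fun p => c * δ p) (c * R) l = c * G.seqPay δ R l := by
  induction l generalizing R with
  | nil => simp [seqPay]
  | cons a l ih =>
    simp only [seqPay]
    rw [← mul_sub, ih]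
    ring

/-- Each guess costs `σ` times the mass not found before it, so the discount is a sum of the masses
of the proper prefixes. Upper bounds on prefix masses thus become upper bounds on the payoff. -/
lemma seqPay_eq_sum (G : CostlyGuessesGame P N) (δ : P → ℝ) (R : ℝ) (l : List P) :
    G.seqPay δ R l = G.γ * (l.map δ).sum - G.σ * (l.length * R)
      + G.σ * ∑ j ∈ Finset.range l.length, ((l.take j).map δ).sum := by
  induction l generalizing R with
  | nil => simp [seqPay]
  | cons a l ih =>
    simp only [seqPay, ih, List.length_cons, Finset.sum_range_succ', List.take_succ_cons,
      List.map_cons, List.sum_cons, Finset.sum_add_distrib, List.take_zero, List.map_nil,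
      List.sum_nil, Finset.sum_const, Finset.card_range, nsmul_eq_mul]
    push_cast
    ring

/-- Guessing secrets of mass zero does not pay. -/
lemma seqPay_le_filter (G : CostlyGuessesGame P N) {δ : P → ℝ} (hδ : ∀ p, 0 ≤ δ p)
    (s : P → Prop) [DecidablePred s] (hs : ∀ p, ¬ s p → δ p = 0) (R : ℝ) (l : List P)
    (hR : (l.map δ).sum ≤ R) :
    G.seqPay δ R l ≤ G.seqPay δ R (l.filter fun p => s p) := by
  induction l generalizing R with
  | nil => simp
  | cons a l ih =>
    simp only [List.map_cons, List.sum_cons] at hR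
    by_cases ha : s a
    · rw [List.filter_cons_of_pos (by simpa using ha)]
      simp only [seqPay]
      gcongr
      exact ih _ (by linarith)
    · rw [List.filter_cons_of_neg (by simpa using ha)]
      have hl : 0 ≤ (l.map δ).sum := List.sum_nonneg (by simpa using fun p _ => hδ p)
      have h0 := hs a ha
      have := ih R (by linarith)
      have := mul_nonneg G.σ_pos.le (by linarith : 0 ≤ R)
      simp only [seqPay, h0, sub_zero]
      linarith

lemma pay_eq_seqPay (G : CostlyGuessesGame P N) (δ : P → ℝ) (A : GuessSeq P) :
    G.pay δ A = G.seqPay δ (∑ d, δ d) A.1 := by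
  obtain ⟨l, hl⟩ := A
  induction l generalizing δ with
  | nil => simp [pay, seqPay, uA, guessPos]
  | cons a l ih =>
    obtain ⟨ha, hl'⟩ := List.nodup_cons.1 hl
    -- After a first guess `a`, the rest is the same game with the mass of `a` deleted; this is why
    -- the induction runs over unnormalised `δ`.
    have hz := ih (Function.update δ a 0) hl'
    have hsum : ∑ d, Function.update δ a 0 d = ∑ d, δ d - δ a := by
      rw [Finset.sum_update_of_mem (Finset.mem_univ a), zero_add,
        ← Finset.sum_sdiff (Finset.subset_univ {a}) (f := δ)]
      simp
    rw [hsum, G.seqPay_congr (δ' := δ) _ l fun b hb => by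
      rw [Function.update_of_ne]; rintro rfl; exact ha hb] at hz
    simp only [seqPay]
    rw [← hz]
    have key : ∀ d, G.uA d ⟨a :: l, hl⟩ * δ d =
        (if d = a then G.γ * δ d else 0) - G.σ * δ d
          + G.uA d ⟨l, hl'⟩ * Function.update δ a 0 d := by
      intro d
      by_cases hd : d = a
      · subst hd
        simp [uA, guessPos]
        ring
      · have hda : a ≠ d := fun h => hd h.symm
        rw [Function.update_of_ne hd]
        by_cases hdl : d ∈ l
        · simp [uA, guessPos, hd, hdl, List.idxOf_cons_ne _ hda]
          ring
        · simp [uA, guessPos, hd, hdl]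
          ring
    simp only [pay, key, Finset.sum_add_distrib, Finset.sum_sub_distrib, Finset.sum_ite_eq',
      Finset.mem_univ, if_true, Finset.mul_sum]

/-! ### Expected utilities as averages over pure sequences -/

lemma cost_eq (G : CostlyGuessesGame P N) {i : Fin N} {p : P} (hp : p ∈ G.E i) :
    G.cost p = G.C i := by
  rw [cost, Finset.sum_eq_single i]
  · simp [hp]
  · intro j _ hj
    rw [if_neg]
    exact fun h => Finset.disjoint_left.1 (G.E_disjoint j i hj) h hp
  · simp

lemma C_zero_le (G : CostlyGuessesGame P N) (i : Fin N) : G.C 0 ≤ G.C i :=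
  G.C_strictMono.monotone (Fin.zero_le i)

lemma C_zero_le_cost (G : CostlyGuessesGame P N) (p : P) : G.C 0 ≤ G.cost p := by
  obtain ⟨i, hi⟩ := G.E_cover p
  rw [G.cost_eq hi]
  exact G.C_zero_le i

lemma sum_classes (G : CostlyGuessesGame P N) (f : P → ℝ) :
    ∑ p, f p = ∑ i, ∑ p ∈ G.E i, f p := by
  rw [← Finset.sum_biUnion fun i _ j _ h => G.E_disjoint i j h]
  congr 1
  ext p
  simpa using G.E_cover p

lemma sum_card_classes (G : CostlyGuessesGame P N) :
    ∑ i, (G.E i).card = Fintype.card P := by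
  rw [← Finset.card_biUnion fun i _ j _ h => G.E_disjoint i j h, ← Finset.card_univ]
  congr 1
  ext p
  simpa using G.E_cover p

lemma expUD_eq (G : CostlyGuessesGame P N) (δ : MixedStrategy P) (α : MixedStrategy (GuessSeq P)) :
    G.expUD δ α = ∑ A, α.1 A * (-G.expCost δ.1 - G.lam * ∑ p ∈ A.1.toFinset, δ.1 p) := by
  rw [expUD, Finset.sum_comm]
  refine Finset.sum_congr rfl fun A _ => ?_
  rw [← Finset.sum_mul, mul_comm]
  congr 1
  have : ∑ p ∈ A.1.toFinset, δ.1 p = ∑ p, if p ∈ A.1 then δ.1 p else 0 := by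
    rw [← Finset.sum_filter]
    congr 1
    ext p
    simp
  rw [this, expCost, Finset.mul_sum, ← Finset.sum_neg_distrib, ← Finset.sum_sub_distrib]
  refine Finset.sum_congr rfl fun p _ => ?_
  rw [uD]
  split_ifs <;> ring

lemma expUA_eq (G : CostlyGuessesGame P N) (δ : MixedStrategy P) (α : MixedStrategy (GuessSeq P)) :
    G.expUA δ α = ∑ A, α.1 A * G.pay δ.1 A := by
  rw [expUA, Finset.sum_comm]
  refine Finset.sum_congr rfl fun A _ => ?_
  rw [← Finset.sum_mul, mul_comm, pay]

lemma findProb_eq (G : CostlyGuessesGame P N) (δ : MixedStrategy P)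
    (α : MixedStrategy (GuessSeq P)) :
    G.findProb δ α = ∑ A, α.1 A * ∑ p ∈ A.1.toFinset, δ.1 p := by
  rw [findProb, Finset.sum_comm]
  refine Finset.sum_congr rfl fun A _ => ?_
  rw [← Finset.sum_mul, mul_comm]
  congr 1
  simp only [ite_mul, one_mul, zero_mul, ← Finset.sum_filter]
  congr 1
  ext p
  simp

/-! ### Best responses -/

/-- The mixed strategy concentrated on one pure strategy. -/
def pureStrategy {S : Type*} [Fintype S] [DecidableEq S] (s : S) : MixedStrategy S :=
  ⟨Pi.single s 1, single_mem_stdSimplex ℝ s⟩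

lemma sum_pureStrategy_mul {S : Type*} [Fintype S] [DecidableEq S] (s : S) (f : S → ℝ) :
    ∑ t, (pureStrategy s).1 t * f t = f s := by
  simp [pureStrategy, Pi.single_apply]

/-- Every pure strategy used in a best response is optimal. -/
lemma IsBestResponse.pay_le {G : CostlyGuessesGame P N} {δ : MixedStrategy P}
    {α : MixedStrategy (GuessSeq P)} (h : G.IsBestResponse δ α) {A : GuessSeq P}
    (hA : 0 < α.1 A) (B : GuessSeq P) : G.pay δ.1 B ≤ G.pay δ.1 A := by
  have hB : ∀ B, G.pay δ.1 B ≤ G.expUA δ α := fun B => by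
    have := h (pureStrategy B)
    rwa [expUA_eq, sum_pureStrategy_mul] at this
  refine (hB B).trans ?_
  by_contra! hlt
  have : G.expUA δ α < ∑ C, α.1 C * G.expUA δ α := by
    conv_lhs => rw [expUA_eq]
    refine Finset.sum_lt_sum (fun C _ => ?_) ⟨A, Finset.mem_univ _, ?_⟩
    · exact mul_le_mul_of_nonneg_left (hB C) (α.2.1 C)
    · exact mul_lt_mul_of_pos_left hlt hA
  rw [← Finset.sum_mul, α.2.2, one_mul] at this
  exact lt_irrefl _ this

lemma isBestResponse_pureStrategy {G : CostlyGuessesGame P N} {δ : MixedStrategy P}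
    {A : GuessSeq P} (hA : ∀ B, G.pay δ.1 B ≤ G.pay δ.1 A) :
    G.IsBestResponse δ (pureStrategy A) := by
  intro α'
  rw [expUA_eq, expUA_eq, sum_pureStrategy_mul]
  calc ∑ B, α'.1 B * G.pay δ.1 B ≤ ∑ B, α'.1 B * G.pay δ.1 A :=
        Finset.sum_le_sum fun B _ => mul_le_mul_of_nonneg_left (hA B) (α'.2.1 B)
    _ = G.pay δ.1 A := by rw [← Finset.sum_mul, α'.2.2, one_mul]

lemma continuous_expUA (G : CostlyGuessesGame P N) (δ : MixedStrategy P) :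
    Continuous fun α => G.expUA δ α := by
  unfold expUA
  exact continuous_finsetSum _ fun d _ => continuous_finsetSum _ fun A _ =>
    continuous_const.mul ((continuous_apply A).comp continuous_subtype_val)

lemma continuous_expUD (G : CostlyGuessesGame P N) (δ : MixedStrategy P) :
    Continuous fun α => G.expUD δ α := by
  unfold expUD
  exact continuous_finsetSum _ fun d _ => continuous_finsetSum _ fun A _ =>
    continuous_const.mul ((continuous_apply A).comp continuous_subtype_val)

/-- The guesser has a best-response map that breaks ties in favour of the picker. -/
lemma exists_bestResponse (G : CostlyGuessesGame P N) :
    ∃ br : MixedStrategy P → MixedStrategy (GuessSeq P),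
      (∀ δ, G.IsBestResponse δ (br δ)) ∧
      ∀ δ α, G.IsBestResponse δ α → G.expUD δ α ≤ G.expUD δ (br δ) := by
  have : ∀ δ, ∃ β, G.IsBestResponse δ β ∧
      ∀ α, G.IsBestResponse δ α → G.expUD δ α ≤ G.expUD δ β := by
    intro δ
    have hne : {α | G.IsBestResponse δ α}.Nonempty := by
      obtain ⟨A, hA⟩ := @Finite.exists_max (GuessSeq P) ℝ _ ⟨⟨[], List.nodup_nil⟩⟩ _
        (G.pay δ.1)
      exact ⟨_, isBestResponse_pureStrategy hA⟩
    have hcl : IsClosed {α | G.IsBestResponse δ α} := by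
      simp only [IsBestResponse, Set.ofPred_forall]
      exact isClosed_iInter fun α' => isClosed_le continuous_const (G.continuous_expUA δ)
    have : CompactSpace (MixedStrategy (GuessSeq P)) :=
      isCompact_iff_compactSpace.1 (isCompact_stdSimplex ℝ _)
    obtain ⟨β, hβ, hmax⟩ := hcl.isCompact.exists_isMaxOn hne (G.continuous_expUD δ).continuousOn
    exact ⟨β, hβ, fun α hα => hmax hα⟩
  choose br h1 h2 using this
  exact ⟨br, h1, h2⟩

/-! ### Distributions on the cheapest class -/

lemma sum_le_one_of_mixed {S : Type*} [Fintype S] (δ : MixedStrategy S) (s : Finset S) :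
    ∑ p ∈ s, δ.1 p ≤ 1 := by
  rw [← δ.2.2]
  exact Finset.sum_le_univ_sum_of_nonneg δ.2.1

lemma C_zero_mul_sum_le (G : CostlyGuessesGame P N) {δ : P → ℝ} (hδ : ∀ p, 0 ≤ δ p)
    (s : Finset P) :
    G.C 0 * ∑ p ∈ s, δ p ≤ ∑ p ∈ s, G.cost p * δ p := by
  rw [Finset.mul_sum]
  exact Finset.sum_le_sum fun p _ => mul_le_mul_of_nonneg_right (G.C_zero_le_cost p) (hδ p)

lemma C_zero_le_expCost (G : CostlyGuessesGame P N) (δ : MixedStrategy P) :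
    G.C 0 ≤ G.expCost δ.1 := by
  have := G.C_zero_mul_sum_le δ.2.1 Finset.univ
  rwa [δ.2.2, mul_one] at this

lemma ChoosesCheapest.eq_zero {G : CostlyGuessesGame P N} {δ : MixedStrategy P}
    (h : G.ChoosesCheapest δ) {p : P} (hp : p ∉ G.E 0) : δ.1 p = 0 := by
  have h1 := Finset.sum_add_sum_compl (G.E 0) δ.1
  rw [ChoosesCheapest] at h
  rw [h, δ.2.2, add_eq_left, Finset.sum_eq_zero_iff_of_nonneg fun p _ => δ.2.1 p] at h1
  exact h1 p (by simpa using hp)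

/-- The excess `cost p - C 0` is nonnegative and, by strict monotonicity of the costs, vanishes only
on the cheapest class. -/
lemma choosesCheapest_iff (G : CostlyGuessesGame P N) (δ : MixedStrategy P) :
    G.ChoosesCheapest δ ↔ G.expCost δ.1 = G.C 0 := by
  have hsub : G.expCost δ.1 - G.C 0 = ∑ p, (G.cost p - G.C 0) * δ.1 p := by
    simp only [sub_mul, Finset.sum_sub_distrib, ← Finset.mul_sum, δ.2.2, mul_one, expCost]
  rw [← sub_eq_zero, hsub]
  constructor
  · intro h
    refine Finset.sum_eq_zero fun p _ => ?_
    by_cases hp : p ∈ G.E 0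
    · rw [G.cost_eq hp, sub_self, zero_mul]
    · rw [h.eq_zero hp, mul_zero]
  · intro h
    rw [Finset.sum_eq_zero_iff_of_nonneg fun p _ =>
      mul_nonneg (sub_nonneg.2 (G.C_zero_le_cost p)) (δ.2.1 p)] at h
    rw [ChoosesCheapest, ← δ.2.2]
    refine Finset.sum_subset (Finset.subset_univ _) fun p _ hp => ?_
    obtain ⟨i, hi⟩ := G.E_cover p
    have hne : (0 : Fin N) < i := by
      rw [Fin.pos_iff_ne_zero]
      rintro rfl
      exact hp hi
    have hlt := G.C_strictMono hne
    have := h p (Finset.mem_univ p)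
    rw [G.cost_eq hi] at this
    exact (mul_eq_zero.1 this).resolve_left (by linarith)

lemma ChoosesCheapest.congr {G : CostlyGuessesGame P N} {δ δ' : MixedStrategy P}
    (h : G.ChoosesCheapest δ) (h' : ∀ p, δ.1 p = 0 → δ'.1 p = 0) : G.ChoosesCheapest δ' := by
  rw [ChoosesCheapest, ← δ'.2.2]
  exact Finset.sum_subset (Finset.subset_univ _) fun p _ hp => h' p (h.eq_zero hp)

lemma exists_choosesCheapest (G : CostlyGuessesGame P N) : ∃ δ, G.ChoosesCheapest δ := by
  obtain ⟨p, hp⟩ := G.E_nonempty 0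
  refine ⟨pureStrategy p, ?_⟩
  simp [ChoosesCheapest, pureStrategy, Pi.single_apply, hp]

/-! ### Conditioning on the unexplored secrets -/

/-- If an optimal sequence leaves secrets of positive mass unexplored, then conditioning on these
secrets gives a deterrent distribution. -/
lemma exists_deterrent_of_unexplored {G : CostlyGuessesGame P N} {δ : MixedStrategy P}
    {A : GuessSeq P} (hA : ∀ B, G.pay δ.1 B ≤ G.pay δ.1 A)
    (hR : 0 < 1 - ∑ p ∈ A.1.toFinset, δ.1 p) :
    ∃ δ' : MixedStrategy P, G.Deterrent δ'.1 ∧ (∀ p, δ.1 p = 0 → δ'.1 p = 0) ∧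
      G.expCost δ.1 = ∑ p ∈ A.1.toFinset, G.cost p * δ.1 p
        + (1 - ∑ p ∈ A.1.toFinset, δ.1 p) * G.expCost δ'.1 := by
  set R := 1 - ∑ p ∈ A.1.toFinset, δ.1 p with hRdef
  have hsplit : ∀ f : P → ℝ, ∑ p, f p = ∑ p ∈ A.1.toFinset, f p
      + ∑ p, if p ∈ A.1 then 0 else f p := by
    intro f
    rw [← Finset.sum_add_sum_compl A.1.toFinset f]
    congr 1
    rw [Finset.sum_ite, Finset.sum_const_zero, zero_add]
    congr 1
    ext p
    simp
  have hsum : ∑ p, (if p ∈ A.1 then 0 else δ.1 p) = R := by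
    have := hsplit δ.1
    rw [δ.2.2] at this
    linarith
  let f : P → ℝ := fun p => if p ∈ A.1 then 0 else R⁻¹ * δ.1 p
  have hf0 : ∀ p, 0 ≤ f p := fun p => by
    simp only [f]
    split_ifs
    · rfl
    · exact mul_nonneg (inv_nonneg.2 hR.le) (δ.2.1 p)
  have hf1 : ∑ p, f p = 1 := by
    rw [← inv_mul_cancel₀ hR.ne', ← hsum, Finset.mul_sum]
    exact Finset.sum_congr rfl fun p _ => by simp only [f, mul_ite, mul_zero, hsum]
  refine ⟨⟨f, hf0, hf1⟩, ?_, fun p hp => by simp [f, hp], ?_⟩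
  · intro B
    change G.pay f B ≤ 0
    have hBsum : (B.1.map f).sum ≤ 1 := by
      rw [← List.sum_toFinset f B.2, ← hf1]
      exact Finset.sum_le_univ_sum_of_nonneg hf0
    have h1 := G.seqPay_le_filter hf0 (fun p => p ∉ A.1) (fun p hp => by simp [f, not_not.1 hp])
      1 B.1 hBsum
    rw [pay_eq_seqPay, hf1]
    refine h1.trans ?_
    -- Secrets already in `A` have mass zero under `f`, so dropping them from `B` does not lower the
    -- payoff, and what is left can be appended to `A` without repetition. Optimality of `A` says
    -- that this continuation earns at most zero.
    set B' := B.1.filter fun p => decide (p ∉ A.1) with hB'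
    have hdisj : ∀ p ∈ B', p ∉ A.1 := fun p hp => by
      simpa using (List.mem_filter.1 hp).2
    have hnd : (A.1 ++ B').Nodup := A.2.append (B.2.filter _) fun p hp hp' => hdisj p hp' hp
    have h2 := hA ⟨A.1 ++ B', hnd⟩
    rw [pay_eq_seqPay, pay_eq_seqPay, seqPay_append, δ.2.2, ← List.sum_toFinset δ.1 A.2,
      ← hRdef] at h2
    rw [G.seqPay_congr (δ' := fun p => R⁻¹ * δ.1 p) _ _ fun p hp => by simp [f, hdisj p hp],
      ← inv_mul_cancel₀ hR.ne', seqPay_smul]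
    exact mul_nonpos_of_nonneg_of_nonpos (inv_nonneg.2 hR.le) (by linarith)
  · rw [expCost, hsplit]
    congr 1
    rw [expCost, Finset.mul_sum]
    refine Finset.sum_congr rfl fun p _ => ?_
    simp only [f]
    split_ifs
    · simp
    · field_simp

/-- The picker's payoff against an optimal sequence is at most a mean of the payoff of a cheapest
secret that is found and the payoff of an optimal deterrent distribution. -/
lemma picker_payoff_le {G : CostlyGuessesGame P N} {D : ℝ}
    (hD : ∀ δ : MixedStrategy P, G.Deterrent δ.1 → -G.expCost δ.1 ≤ D)
    {δ : MixedStrategy P} {A : GuessSeq P} (hA : ∀ B, G.pay δ.1 B ≤ G.pay δ.1 A) :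
    -G.expCost δ.1 - G.lam * ∑ p ∈ A.1.toFinset, δ.1 p ≤
      (∑ p ∈ A.1.toFinset, δ.1 p) * (-G.C 0 - G.lam)
        + (1 - ∑ p ∈ A.1.toFinset, δ.1 p) * D := by
  have hM : ∑ p ∈ A.1.toFinset, δ.1 p ≤ 1 := sum_le_one_of_mixed δ _
  rcases hM.eq_or_lt with h | h
  · rw [h]
    have := G.C_zero_le_expCost δ
    linarith
  · obtain ⟨δ', hd, -, hc⟩ := exists_deterrent_of_unexplored hA (sub_pos.2 h)
    have h1 := G.C_zero_mul_sum_le δ.2.1 A.1.toFinset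
    have h2 := mul_le_mul_of_nonneg_left (hD δ' hd) (sub_pos.2 h).le
    rw [hc]
    linarith

/-- Every sequence used in a best response is optimal, so `picker_payoff_le` bounds its value by a
mean of `-C 0 - lam` and `D`, both at most `D`. -/
lemma expUD_le {G : CostlyGuessesGame P N} {D : ℝ}
    (hD : ∀ δ : MixedStrategy P, G.Deterrent δ.1 → -G.expCost δ.1 ≤ D)
    (hle : -G.C 0 - G.lam ≤ D) {δ : MixedStrategy P} {α : MixedStrategy (GuessSeq P)}
    (h : G.IsBestResponse δ α) : G.expUD δ α ≤ D := by
  rw [expUD_eq]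
  calc _ ≤ ∑ A, α.1 A * D := Finset.sum_le_sum fun A _ => ?_
    _ = D := by rw [← Finset.sum_mul, α.2.2, one_mul]
  rcases (α.2.1 A).eq_or_lt with h0 | h0
  · simp [← h0]
  · refine mul_le_mul_of_nonneg_left ((picker_payoff_le hD (h.pay_le h0)).trans ?_) h0.le
    have hM : 0 ≤ ∑ p ∈ A.1.toFinset, δ.1 p := Finset.sum_nonneg fun p _ => δ.2.1 p
    nlinarith

/-- Quitting is a best response to `δ` and costs the picker no `lam`; favourable tie-breaking does
at least as well. -/
lemma Deterrent.expUD_ge {G : CostlyGuessesGame P N} {δ : MixedStrategy P}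
    (hδ : G.Deterrent δ.1) {β : MixedStrategy (GuessSeq P)}
    (hβ : ∀ α, G.IsBestResponse δ α → G.expUD δ α ≤ G.expUD δ β) :
    -G.expCost δ.1 ≤ G.expUD δ β := by
  have h0 : G.pay δ.1 ⟨[], List.nodup_nil⟩ = 0 := by simp [pay_eq_seqPay, seqPay]
  have := hβ _ (isBestResponse_pureStrategy (A := ⟨[], List.nodup_nil⟩) fun B => by
    rw [h0]
    exact hδ B)
  rw [expUD_eq, sum_pureStrategy_mul] at this
  simpa using this

/-! ### The two kinds of equilibrium -/

/-- When a deterrent distribution is better than a cheapest secret that is found, the optimal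
deterrent distributions are SSE strategies. -/
lemma sse_of_optimal_deterrent {G : CostlyGuessesGame P N} {D : ℝ}
    (hD : ∀ δ : MixedStrategy P, G.Deterrent δ.1 → -G.expCost δ.1 ≤ D)
    (hle : -G.C 0 - G.lam ≤ D) {δ : MixedStrategy P} (hδ : G.Deterrent δ.1)
    (hopt : -G.expCost δ.1 = D) :
    G.IsSSEStrategy δ ∧ ∀ δ' br, G.IsSSE δ' br → G.expUD δ' (br δ') = D := by
  refine ⟨?_, fun δ' br h => le_antisymm (expUD_le hD hle (h.best_response δ')) ?_⟩
  · obtain ⟨br, h1, h2⟩ := G.exists_bestResponse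
    exact ⟨br, fun δ' => (expUD_le hD hle (h1 δ')).trans (hopt ▸ hδ.expUD_ge (h2 δ)), h1, h2⟩
  · exact hopt ▸ (hδ.expUD_ge (h.ties_for_leader δ)).trans (h.leader_optimal δ)

/-- When no deterrent distribution is as good as a cheapest secret that is found, choosing from the
cheapest class is the SSE strategy. -/
lemma cheapestIsTheSSE_of_deterrent_lt {G : CostlyGuessesGame P N}
    (hD : ∀ δ : MixedStrategy P, G.Deterrent δ.1 → -G.expCost δ.1 < -G.C 0 - G.lam) :
    G.CheapestIsTheSSE := by
  -- A positive unexplored mass would yield a deterrent distribution still supported on the cheapest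
  -- class, worth `-C 0` to the picker, against `hD`.
  have hall : ∀ δ, G.ChoosesCheapest δ → ∀ A : GuessSeq P, (∀ B, G.pay δ.1 B ≤ G.pay δ.1 A) →
      ∑ p ∈ A.1.toFinset, δ.1 p = 1 := by
    intro δ hδ A hA
    by_contra hne
    have hM : ∑ p ∈ A.1.toFinset, δ.1 p ≤ 1 := sum_le_one_of_mixed δ _
    obtain ⟨δ', hd, hz, -⟩ := exists_deterrent_of_unexplored hA (sub_pos.2 (hM.lt_of_ne hne))
    have := hD δ' hd
    rw [(G.choosesCheapest_iff δ').1 (hδ.congr hz)] at this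
    linarith [G.lam_pos]
  -- The general `f` serves twice: affine for the picker's utility, the identity for the probability
  -- of finding the secret.
  have hfound : ∀ δ, G.ChoosesCheapest δ → ∀ α, G.IsBestResponse δ α → ∀ f : ℝ → ℝ,
      ∑ A, α.1 A * f (∑ p ∈ A.1.toFinset, δ.1 p) = f 1 := by
    intro δ hδ α hα f
    generalize hy : f 1 = y
    rw [← one_mul y, ← α.2.2, Finset.sum_mul, ← hy]
    refine Finset.sum_congr rfl fun A _ => ?_
    rcases (α.2.1 A).eq_or_lt with h0 | h0
    · simp [← h0]
    · rw [hall δ hδ A (hα.pay_le h0)]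
  have hval : ∀ δ, G.ChoosesCheapest δ → ∀ α, G.IsBestResponse δ α →
      G.expUD δ α = -G.C 0 - G.lam := by
    intro δ hδ α hα
    rw [expUD_eq, hfound δ hδ α hα fun x => -G.expCost δ.1 - G.lam * x,
      (G.choosesCheapest_iff δ).1 hδ, mul_one]
  have hle : ∀ δ α, G.IsBestResponse δ α → G.expUD δ α ≤ -G.C 0 - G.lam := fun δ α hα =>
    expUD_le (fun δ hδ => (hD δ hδ).le) le_rfl hα
  -- Strictness has two sources: if everything is found, the expected cost exceeds `C 0`; otherwise
  -- the unexplored part falls under the strict inequality `hD`.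
  have hpure : ∀ δ : MixedStrategy P, ∀ A : GuessSeq P, (∀ B, G.pay δ.1 B ≤ G.pay δ.1 A) →
      ¬ G.ChoosesCheapest δ →
      -G.expCost δ.1 - G.lam * ∑ p ∈ A.1.toFinset, δ.1 p < -G.C 0 - G.lam := by
    intro δ A hA hδ
    have hM : ∑ p ∈ A.1.toFinset, δ.1 p ≤ 1 := sum_le_one_of_mixed δ _
    rcases hM.eq_or_lt with h | h
    · rw [h]
      have := (G.C_zero_le_expCost δ).lt_of_ne fun h' => hδ ((G.choosesCheapest_iff δ).2 h'.symm)
      linarith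
    · obtain ⟨δ', hd, -, hc⟩ := exists_deterrent_of_unexplored hA (sub_pos.2 h)
      have h1 := G.C_zero_mul_sum_le δ.2.1 A.1.toFinset
      have h2 := mul_lt_mul_of_pos_left (hD δ' hd) (sub_pos.2 h)
      rw [hc]
      linarith
  have hlt : ∀ δ α, G.IsBestResponse δ α → ¬ G.ChoosesCheapest δ →
      G.expUD δ α < -G.C 0 - G.lam := by
    intro δ α hα hδ
    obtain ⟨A, hA⟩ : ∃ A, 0 < α.1 A := by
      by_contra! h
      have := Finset.sum_nonpos fun A (_ : A ∈ Finset.univ) => h A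
      rw [α.2.2] at this
      linarith
    rw [expUD_eq]
    calc _ < ∑ A, α.1 A * (-G.C 0 - G.lam) := ?_
      _ = _ := by rw [← Finset.sum_mul, α.2.2, one_mul]
    refine Finset.sum_lt_sum (fun B _ => ?_) ⟨A, Finset.mem_univ _, ?_⟩
    · rcases (α.2.1 B).eq_or_lt with h0 | h0
      · simp [← h0]
      · exact mul_le_mul_of_nonneg_left (hpure δ B (hα.pay_le h0) hδ).le h0.le
    · exact mul_lt_mul_of_pos_left (hpure δ A (hα.pay_le hA) hδ) hA
  have hge : ∀ δ br, G.IsSSE δ br → -G.C 0 - G.lam ≤ G.expUD δ (br δ) := by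
    intro δ br h
    obtain ⟨δ₀, h₀⟩ := G.exists_choosesCheapest
    exact (hval δ₀ h₀ _ (h.best_response δ₀)).symm.trans_le (h.leader_optimal δ₀)
  refine ⟨fun δ => ⟨?_, fun hδ => ?_⟩, fun δ br h => ?_, fun δ hδ α hα A hA => ?_,
    fun δ hδ α hα => ?_⟩
  · rintro ⟨br, h⟩
    by_contra hδ
    exact (hge δ br h).not_gt (hlt δ _ (h.best_response δ) hδ)
  · obtain ⟨br, h1, h2⟩ := G.exists_bestResponse
    exact ⟨br, fun δ' => (hle δ' _ (h1 δ')).trans (hval δ hδ _ (h1 δ)).ge, h1, h2⟩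
  · exact le_antisymm (hle δ _ (h.best_response δ)) (hge δ br h)
  · have h1 := hall δ hδ A (hα.pay_le hA)
    refine ⟨fun h => by simp [h] at h1, fun p hp => ?_⟩
    by_contra hpA
    have h2 := Finset.sum_add_sum_compl A.1.toFinset δ.1
    rw [h1, δ.2.2, add_eq_left, Finset.sum_eq_zero_iff_of_nonneg fun p _ => δ.2.1 p] at h2
    exact hp.ne' (h2 p (by simpa using hpA))
  · rw [findProb_eq]
    exact hfound δ hδ α hα fun x => x

/-- If guessing all the secrets in a random order pays, then no distribution is deterrent. -/
lemma not_deterrent (G : CostlyGuessesGame P N)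
    (h : ((Fintype.card P : ℝ) + 1) * G.σ / 2 < G.γ) (δ : MixedStrategy P) :
    ¬ G.Deterrent δ.1 := by
  intro hd
  have h1 := hd ⟨Finset.univ.toList, Finset.nodup_toList _⟩
  have h2 := hd ⟨Finset.univ.toList.reverse, List.nodup_reverse.2 (Finset.nodup_toList _)⟩
  have h3 := G.seqPay_add_reverse δ.1 1 Finset.univ.toList
  rw [pay_eq_seqPay, δ.2.2] at h1 h2
  rw [Finset.sum_map_toList, δ.2.2, Finset.length_toList, Finset.card_univ] at h3
  linarith

/-! ### From feasible class masses to deterrent distributions -/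

/-- The number of secrets in the classes before the class `i`. -/
def cardBefore (G : CostlyGuessesGame P N) (i : Fin N) : ℕ :=
  ∑ j ∈ Finset.Iio i, (G.E j).card

/-- The expected number of guesses, up to the classes in `s`, when the classes are guessed in
their order. -/
def guessCount (G : CostlyGuessesGame P N) (ν : Fin N → ℝ) (s : Finset (Fin N)) : ℝ :=
  ∑ i ∈ s, (((G.E i).card : ℝ) * (1 - ∑ j ∈ Finset.Iio i, ν j)
    - (((G.E i).card : ℝ) - 1) / 2 * ν i)

lemma card_pos (G : CostlyGuessesGame P N) (i : Fin N) : (0 : ℝ) < (G.E i).card := by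
  exact_mod_cast Finset.card_pos.2 (G.E_nonempty i)

/-- A position among the secrets lies in one of the classes. -/
lemma exists_class_of_le (G : CostlyGuessesGame P N) {k : ℕ} (hk : k ≤ Fintype.card P) :
    ∃ i r, k = G.cardBefore i + r ∧ r ≤ (G.E i).card := by
  by_contra! hcon
  have hlt : ∀ n, ∀ i : Fin N, (i : ℕ) = n → G.cardBefore i + (G.E i).card < k := by
    intro n
    induction n with
    | zero =>
      intro i hi
      have h0 : G.cardBefore i = 0 := by
        rcases Iio_eq_empty_or i with h | ⟨j, hj, -⟩
        · rw [cardBefore, h, Finset.sum_empty]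
        · omega
      have := hcon i k (by omega)
      omega
    | succ n ih =>
      intro i hi
      have hj := ih ⟨n, by omega⟩ rfl
      have h0 : G.cardBefore i = G.cardBefore ⟨n, by omega⟩ + (G.E ⟨n, by omega⟩).card := by
        rw [cardBefore, Iio_eq_Iic (i := ⟨n, by omega⟩) hi, ← Finset.Iio_insert,
          Finset.sum_insert (by simp), add_comm]
        rfl
      have := hcon i (k - G.cardBefore i) (by omega)
      omega
  have hN := NeZero.pos N
  have hlast := hlt _ ⟨N - 1, by omega⟩ rfl
  have htot := G.sum_card_classes
  have huniv : (Finset.univ : Finset (Fin N)) = insert ⟨N - 1, by omega⟩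
      (Finset.Iio ⟨N - 1, by omega⟩) := by
    rw [Finset.Iio_insert]
    ext j
    simp only [Finset.mem_univ, Finset.mem_Iic, Fin.le_def, true_iff]
    omega
  rw [huniv, Finset.sum_insert (by simp)] at htot
  rw [cardBefore] at hlast
  omega

/-- The masses of `k` secrets sum to at most the concave envelope of the sorted partial sums. -/
lemma sum_list_le_line (G : CostlyGuessesGame P N) {d : Fin N → ℝ} (hd : Antitone d) {δ : P → ℝ}
    (hδ : ∀ i, ∀ p ∈ G.E i, δ p = d i) {l : List P} (hl : l.Nodup) (i : Fin N) :
    (l.map δ).sum ≤ ∑ j ∈ Finset.Iio i, (G.E j).card * d j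
      + ((l.length : ℝ) - G.cardBefore i) * d i := by
  -- With threshold `d i`, the excess over it summed along the list is at most the sum of all
  -- positive parts, and only the classes before `i` contribute to these.
  have h1 : (l.map δ).sum - l.length * d i ≤ ∑ p, max (δ p - d i) 0 := by
    rw [← List.sum_toFinset δ hl, ← List.toFinset_card_of_nodup hl, ← nsmul_eq_mul,
      ← Finset.sum_const, ← Finset.sum_sub_distrib]
    refine (Finset.sum_le_sum fun p _ => le_max_left _ (0 : ℝ)).trans ?_
    exact Finset.sum_le_univ_sum_of_nonneg fun p => le_max_right _ _
  have h2 : ∑ p, max (δ p - d i) 0 = ∑ j ∈ Finset.Iio i, (G.E j).card * (d j - d i) := by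
    rw [G.sum_classes, ← Finset.sum_subset (Finset.subset_univ (Finset.Iio i))]
    · refine Finset.sum_congr rfl fun j hj => ?_
      rw [← nsmul_eq_mul, ← Finset.sum_const]
      refine Finset.sum_congr rfl fun p hp => ?_
      rw [hδ j p hp, max_eq_left (sub_nonneg.2 (hd (Finset.mem_Iio.1 hj).le))]
    · intro j _ hj
      refine Finset.sum_eq_zero fun p hp => ?_
      rw [hδ j p hp, max_eq_right (sub_nonpos.2 (hd (by simpa using hj)))]
  rw [h2] at h1
  simp only [mul_sub, Finset.sum_sub_distrib, ← Finset.sum_mul] at h1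
  rw [cardBefore]
  push_cast
  linarith

/-- Class-constant masses that satisfy the constraints of the linear program are deterrent. -/
lemma LPFeasible.deterrent {G : CostlyGuessesGame P N} {ν : Fin N → ℝ} (h : G.LPFeasible ν)
    {δ : P → ℝ} (hδ : ∀ i, ∀ p ∈ G.E i, δ p = ν i / ((G.E i).card : ℝ)) (hδ1 : ∑ p, δ p = 1) :
    G.Deterrent δ := by
  intro A
  rw [pay_eq_seqPay, hδ1, seqPay_eq_sum]
  -- `T j` is the mass found by the first `j` guesses, with `T 0 = 0`; guess number `j + 1` is paid
  -- for with probability `1 - T j`.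
  set T : ℕ → ℝ := fun j => ((A.1.take j).map δ).sum with hT
  set d : Fin N → ℝ := fun i => ν i / ((G.E i).card : ℝ) with hd
  have hed : ∀ i, (G.E i).card * d i = ν i := fun i => mul_div_cancel₀ _ (G.card_pos i).ne'
  have hline : ∀ i r, G.cardBefore i + r ≤ A.1.length →
      T (G.cardBefore i + r) ≤ ∑ j ∈ Finset.Iio i, ν j + r * d i := by
    intro i r hr
    have := G.sum_list_le_line (antitone_of_adjacent h.density_mono) hδ
      (A.2.sublist (List.take_sublist (G.cardBefore i + r) A.1)) i
    rw [List.length_take, min_eq_left hr] at this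
    simp only [hT]
    push_cast at this
    rw [add_sub_cancel_left] at this
    rwa [Finset.sum_congr rfl fun j _ => hed j] at this
  -- Summing the linear bound `hline` over `r` guesses inside a class gives a quadratic in `r`;
  -- `hstart` chains these bounds over the earlier classes.
  have hblock : ∀ i r, G.cardBefore i + r ≤ A.1.length →
      ∑ j ∈ Finset.range (G.cardBefore i), T j - G.cardBefore i
        ≤ -G.guessCount ν (Finset.Iio i) →
      ∑ j ∈ Finset.range (G.cardBefore i + r), T j - ((G.cardBefore i + r : ℕ) : ℝ)
        ≤ -G.guessCount ν (Finset.Iio i)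
          - (r * (1 - ∑ j ∈ Finset.Iio i, ν j) - r * (r - 1) / 2 * d i) := by
    intro i r hr h0
    induction r with
    | zero => simpa using h0
    | succ r ih =>
      have h1 := ih (by omega)
      have h2 := hline i r (by omega)
      rw [← add_assoc, Finset.sum_range_succ]
      push_cast at h1 ⊢
      linarith
  have hstart : ∀ n (i : Fin N), (i : ℕ) = n → G.cardBefore i ≤ A.1.length →
      ∑ j ∈ Finset.range (G.cardBefore i), T j - G.cardBefore i
        ≤ -G.guessCount ν (Finset.Iio i) := by
    intro n
    induction n with
    | zero =>
      intro i hi _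
      rcases Iio_eq_empty_or i with h0 | ⟨j, hj, -⟩
      · simp [cardBefore, guessCount, h0]
      · omega
    | succ n ih =>
      intro i hi hle
      obtain ⟨j, hj⟩ : ∃ j : Fin N, (j : ℕ) = n := ⟨⟨n, by omega⟩, rfl⟩
      have hij : Finset.Iio i = Finset.Iic j := Iio_eq_Iic (by omega)
      have hm : G.cardBefore i = G.cardBefore j + (G.E j).card := by
        rw [cardBefore, hij, ← Finset.Iio_insert, Finset.sum_insert (by simp), add_comm]
        rfl
      rw [hm] at hle ⊢
      refine (hblock j _ hle (ih j hj (by omega))).trans ?_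
      rw [hij, guessCount, guessCount, sum_Iic_eq]
      have := hed j
      have h3 : ((G.E j).card : ℝ) * ((G.E j).card - 1) / 2 * d j
          = (((G.E j).card : ℝ) - 1) / 2 * ν j := by rw [← this]; ring
      linarith
  obtain ⟨i, r, hk, hr⟩ := G.exists_class_of_le A.2.length_le_card
  have h1 := hblock i r hk.ge (hstart _ i rfl (by omega))
  have h2 := hline i r hk.ge
  rw [← hk] at h1 h2
  have hTk : (A.1.map δ).sum = T A.1.length := by simp only [hT, List.take_length]
  rw [hTk, mul_one]
  -- Value of the quadratic at `r = 0`: the deterrence constraint of the preceding class, or zero if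
  -- there is none. `hq1` is the value at the end of class `i`.
  have hq0 : G.γ * ∑ j ∈ Finset.Iio i, ν j - G.σ * G.guessCount ν (Finset.Iio i) ≤ 0 := by
    rcases Iio_eq_empty_or i with h0 | ⟨j, -, h0⟩
    · simp [guessCount, h0]
    · rw [h0]
      exact h.deterrence j
  have hq1 := h.deterrence i
  change _ - G.σ * G.guessCount ν (Finset.Iic i) ≤ 0 at hq1
  rw [guessCount, sum_Iic_eq, sum_Iic_eq, ← guessCount] at hq1
  have he := G.card_pos i
  have hr' : (r : ℝ) ≤ (G.E i).card := by exact_mod_cast hr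
  have hr0 : (0 : ℝ) ≤ r := Nat.cast_nonneg r
  have hd0 : 0 ≤ d i := div_nonneg (h.nonneg i) he.le
  have h1' := mul_le_mul_of_nonneg_left h1 G.σ_pos.le
  have h2' := mul_le_mul_of_nonneg_left h2 G.γ_pos.le
  rw [← hed i] at hq1
  generalize ∑ j ∈ Finset.Iio i, ν j = S at *
  generalize G.guessCount ν (Finset.Iio i) = Q at *
  generalize ((G.E i).card : ℝ) = e at *
  generalize d i = x at *
  -- As a function `q` of `r` this is a quadratic with leading coefficient `σ x / 2 ≥ 0`, and `e * q
  -- r = (e - r) * q 0 + r * q e - σ x e r (e - r) / 2`. All three terms are nonpositive for `0 ≤ r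
  -- ≤ e`.
  suffices hq : G.γ * (S + r * x)
      + G.σ * (-Q - (r * (1 - S) - r * ((r : ℝ) - 1) / 2 * x)) ≤ 0 by linarith
  have hc0 := mul_le_mul_of_nonneg_left hq0 (sub_nonneg.2 hr')
  have hc1 := mul_le_mul_of_nonneg_left hq1 hr0
  have hc2 : 0 ≤ G.σ * x * e * r * (e - r) := by
    have := sub_nonneg.2 hr'
    have := G.σ_pos.le
    positivity
  refine nonpos_of_mul_nonpos_right (a := e) ?_ he
  nlinarith

/-- The mixed strategy with the class masses `ν`, uniform on each class. -/
lemma LPFeasible.exists_mixedStrategy {G : CostlyGuessesGame P N} {ν : Fin N → ℝ}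
    (h : G.LPFeasible ν) : ∃ δ : MixedStrategy P,
      (∀ i, ∀ p ∈ G.E i, δ.1 p = ν i / ((G.E i).card : ℝ)) ∧ G.Deterrent δ.1 ∧
      -G.expCost δ.1 = G.lpObjective ν := by
  choose c hc using G.E_cover
  have hcl : ∀ i, ∀ p ∈ G.E i, c p = i := fun i p hp => by
    by_contra hne
    exact Finset.disjoint_left.1 (G.E_disjoint _ _ hne) (hc p) hp
  let f : P → ℝ := fun p => ν (c p) / ((G.E (c p)).card : ℝ)
  have hf : ∀ i, ∀ p ∈ G.E i, f p = ν i / ((G.E i).card : ℝ) := fun i p hp => by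
    simp only [f, hcl i p hp]
  have hsum : ∀ i, ∑ p ∈ G.E i, f p = ν i := fun i => by
    rw [Finset.sum_congr rfl (hf i), Finset.sum_const, nsmul_eq_mul,
      mul_div_cancel₀ _ (G.card_pos i).ne']
  have h1 : ∑ p, f p = 1 := by
    rw [G.sum_classes, Finset.sum_congr rfl fun i _ => hsum i, h.sum_eq_one]
  refine ⟨⟨f, fun p => div_nonneg (h.nonneg _) (Nat.cast_nonneg _), h1⟩, hf, h.deterrent hf h1, ?_⟩
  rw [expCost, lpObjective, G.sum_classes]
  refine congrArg _ (Finset.sum_congr rfl fun i _ => ?_)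
  rw [← hsum i, Finset.mul_sum]
  exact Finset.sum_congr rfl fun p hp => by rw [G.cost_eq hp]

/-! ### From deterrent distributions to feasible class masses -/

/-- The masses of the classes. -/
def classMass (G : CostlyGuessesGame P N) (δ : P → ℝ) (i : Fin N) : ℝ :=
  ∑ p ∈ G.E i, δ p

lemma lpObjective_classMass (G : CostlyGuessesGame P N) (δ : P → ℝ) :
    G.lpObjective (G.classMass δ) = -G.expCost δ := by
  rw [expCost, lpObjective, G.sum_classes]
  refine congrArg _ (Finset.sum_congr rfl fun i _ => ?_)
  rw [classMass, Finset.mul_sum]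
  exact Finset.sum_congr rfl fun p hp => by rw [G.cost_eq hp]

/-- Some enumeration of the first classes earns at least the mean payoff over the orders within
the classes. -/
lemma exists_list_classes (G : CostlyGuessesGame P N) (δ : P → ℝ) (n : ℕ) :
    ∀ K : Fin N, (K : ℕ) = n → ∃ l : List P, l.Nodup ∧
      (∀ p, p ∈ l ↔ ∃ i ≤ K, p ∈ G.E i) ∧
      (l.map δ).sum = ∑ i ∈ Finset.Iic K, G.classMass δ i ∧
      G.γ * ∑ i ∈ Finset.Iic K, G.classMass δ i
        - G.σ * G.guessCount (G.classMass δ) (Finset.Iic K) ≤ G.seqPay δ 1 l := by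
  have hstep : ∀ (K : Fin N) (l : List P), l.Nodup → (∀ p, p ∈ l ↔ ∃ i < K, p ∈ G.E i) →
      (l.map δ).sum = ∑ i ∈ Finset.Iio K, G.classMass δ i →
      G.γ * ∑ i ∈ Finset.Iio K, G.classMass δ i
        - G.σ * G.guessCount (G.classMass δ) (Finset.Iio K) ≤ G.seqPay δ 1 l →
      ∃ l : List P, l.Nodup ∧ (∀ p, p ∈ l ↔ ∃ i ≤ K, p ∈ G.E i) ∧
        (l.map δ).sum = ∑ i ∈ Finset.Iic K, G.classMass δ i ∧
        G.γ * ∑ i ∈ Finset.Iic K, G.classMass δ i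
          - G.σ * G.guessCount (G.classMass δ) (Finset.Iic K) ≤ G.seqPay δ 1 l := by
    intro K l hnd hmem hsum hpay
    have key : ∀ b : List P, b.Nodup → (∀ p, p ∈ b ↔ p ∈ G.E K) →
        (b.map δ).sum = G.classMass δ K →
        G.γ * G.classMass δ K - G.σ * ((G.E K).card * (1 - ∑ i ∈ Finset.Iio K, G.classMass δ i)
          - (((G.E K).card : ℝ) - 1) / 2 * G.classMass δ K)
          ≤ G.seqPay δ (1 - ∑ i ∈ Finset.Iio K, G.classMass δ i) b →
        ∃ l : List P, l.Nodup ∧ (∀ p, p ∈ l ↔ ∃ i ≤ K, p ∈ G.E i) ∧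
          (l.map δ).sum = ∑ i ∈ Finset.Iic K, G.classMass δ i ∧
          G.γ * ∑ i ∈ Finset.Iic K, G.classMass δ i
            - G.σ * G.guessCount (G.classMass δ) (Finset.Iic K) ≤ G.seqPay δ 1 l := by
      intro b hb hbmem hbsum hbpay
      refine ⟨l ++ b, hnd.append hb ?_, ?_, ?_, ?_⟩
      · intro p hp hpb
        obtain ⟨i, hi, hpi⟩ := (hmem p).1 hp
        exact Finset.disjoint_left.1 (G.E_disjoint i K hi.ne) hpi ((hbmem p).1 hpb)
      · intro p
        rw [List.mem_append, hmem, hbmem]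
        constructor
        · rintro (⟨i, hi, hp⟩ | hp)
          · exact ⟨i, hi.le, hp⟩
          · exact ⟨K, le_rfl, hp⟩
        · rintro ⟨i, hi, hp⟩
          rcases hi.eq_or_lt with rfl | hi
          · exact Or.inr hp
          · exact Or.inl ⟨i, hi, hp⟩
      · rw [List.map_append, List.sum_append, hsum, hbsum, sum_Iic_eq]
      · rw [seqPay_append, hsum, guessCount, sum_Iic_eq, sum_Iic_eq, ← guessCount]
        linarith
    -- The two orders of the class average to the required payoff, so the better one reaches it.
    have hrev := G.seqPay_add_reverse δ (1 - ∑ i ∈ Finset.Iio K, G.classMass δ i) (G.E K).toList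
    rw [Finset.sum_map_toList, Finset.length_toList] at hrev
    rcases le_total (G.seqPay δ (1 - ∑ i ∈ Finset.Iio K, G.classMass δ i) (G.E K).toList)
      (G.seqPay δ (1 - ∑ i ∈ Finset.Iio K, G.classMass δ i) (G.E K).toList.reverse) with hle | hle
    · refine key (G.E K).toList.reverse (List.nodup_reverse.2 (Finset.nodup_toList _)) (by simp) ?_ ?_
      · rw [List.map_reverse, List.sum_reverse, Finset.sum_map_toList, classMass]
      · rw [← classMass] at hrev
        linarith
    · refine key (G.E K).toList (Finset.nodup_toList _) (by simp) ?_ ?_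
      · rw [Finset.sum_map_toList, classMass]
      · rw [← classMass] at hrev
        linarith
  induction n with
  | zero =>
    intro K hK
    rcases Iio_eq_empty_or K with h0 | ⟨j, hj, -⟩
    · refine hstep K [] List.nodup_nil (fun p => ?_) (by simp [h0]) (by simp [h0, guessCount, seqPay])
      simp only [List.not_mem_nil, false_iff, not_exists, not_and, Fin.lt_def]
      intro i hi
      omega
    · omega
  | succ n ih =>
    intro K hK
    obtain ⟨j, hj⟩ : ∃ j : Fin N, (j : ℕ) = n := ⟨⟨n, by omega⟩, rfl⟩
    have hKj : Finset.Iio K = Finset.Iic j := Iio_eq_Iic (by omega)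
    obtain ⟨l, h1, h2, h3, h4⟩ := ih j hj
    refine hstep K l h1 (fun p => ?_) (hKj ▸ h3) (hKj ▸ h4)
    rw [h2]
    refine exists_congr fun i => and_congr_left fun _ => ?_
    rw [Fin.lt_def, Fin.le_def]
    omega

/-- The class masses of a deterrent distribution that prefers cheaper classes are feasible. -/
lemma Deterrent.lpFeasible {G : CostlyGuessesGame P N} {δ : MixedStrategy P}
    (hδ : G.Deterrent δ.1)
    (hmono : ∀ i j, i < j → ∀ p ∈ G.E i, ∀ q ∈ G.E j, δ.1 q ≤ δ.1 p) :
    G.LPFeasible (G.classMass δ.1) := by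
  refine ⟨fun i => Finset.sum_nonneg fun p _ => δ.2.1 p, ?_, fun i j hij => ?_, fun K => ?_⟩
  · rw [← δ.2.2, G.sum_classes]
    rfl
  · have hlt : i < j := by rw [Fin.lt_def]; omega
    rw [div_le_div_iff₀ (G.card_pos j) (G.card_pos i), classMass, classMass, Finset.sum_mul,
      Finset.sum_mul]
    -- The comparison of densities, cleared of denominators, is a sum of pointwise comparisons over
    -- all pairs from the two classes.
    calc ∑ q ∈ G.E j, δ.1 q * ((G.E i).card : ℝ) = ∑ q ∈ G.E j, ∑ p ∈ G.E i, δ.1 q := by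
          simp [mul_comm]
      _ ≤ ∑ q ∈ G.E j, ∑ p ∈ G.E i, δ.1 p := Finset.sum_le_sum fun q hq =>
          Finset.sum_le_sum fun p hp => hmono i j hlt p hp q hq
      _ = ∑ p ∈ G.E i, δ.1 p * ((G.E j).card : ℝ) := by
          simp [Finset.sum_mul, mul_comm]
  · obtain ⟨l, hl, -, -, hpay⟩ := G.exists_list_classes δ.1 K K rfl
    have := hδ ⟨l, hl⟩
    rw [pay_eq_seqPay, δ.2.2] at this
    exact hpay.trans this

/-! ### Optimal deterrent distributions -/

/-- An optimal deterrent distribution prefers cheaper classes. -/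
lemma Deterrent.mono_of_optimal {G : CostlyGuessesGame P N} {δ : MixedStrategy P}
    (hδ : G.Deterrent δ.1)
    (hopt : ∀ δ' : MixedStrategy P, G.Deterrent δ'.1 → G.expCost δ.1 ≤ G.expCost δ'.1)
    {i j : Fin N} (hij : i < j) {p q : P} (hp : p ∈ G.E i) (hq : q ∈ G.E j) :
    δ.1 q ≤ δ.1 p := by
  by_contra! hlt
  have hpq : p ≠ q := by
    rintro rfl
    exact lt_irrefl _ hlt
  have hs1 : ∑ x, (δ.1 ∘ Equiv.swap p q) x = 1 := by
    rw [← δ.2.2]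
    exact Equiv.sum_comp (Equiv.swap p q) δ.1
  -- Exchanging the masses of `p` and `q` preserves deterrence, because guessing `A` against the new
  -- distribution is guessing the swapped list against `δ`.
  have h1 := hopt ⟨δ.1 ∘ Equiv.swap p q, fun x => δ.2.1 _, hs1⟩ fun A => by
    have := hδ ⟨A.1.map (Equiv.swap p q), A.2.map (Equiv.swap p q).injective⟩
    rw [pay_eq_seqPay, δ.2.2] at this
    change G.pay (δ.1 ∘ Equiv.swap p q) A ≤ 0
    rwa [pay_eq_seqPay, hs1, seqPay_map]
  have h2 : ∑ x, G.cost x * ((δ.1 ∘ Equiv.swap p q) x - δ.1 x)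
      = (G.C i - G.C j) * (δ.1 q - δ.1 p) := by
    rw [← Finset.sum_subset (Finset.subset_univ {p, q}), Finset.sum_pair hpq, G.cost_eq hp,
      G.cost_eq hq]
    · simp
      ring
    · intro x _ hx
      simp only [Finset.mem_insert, Finset.mem_singleton, not_or] at hx
      simp [Equiv.swap_apply_of_ne_of_ne hx.1 hx.2]
  simp only [mul_sub, Finset.sum_sub_distrib] at h2
  have h3 := mul_pos (sub_pos.2 (G.C_strictMono hij)) (sub_pos.2 hlt)
  simp only [expCost] at h1
  linarith

/-- Deterrence is a family of weak inequalities linear in `δ`, so it cuts a compact set out of the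
simplex, on which the linear cost attains its minimum. -/
lemma exists_optimal_deterrent {G : CostlyGuessesGame P N}
    (hne : ∃ δ : MixedStrategy P, G.Deterrent δ.1) :
    ∃ δ : MixedStrategy P, G.Deterrent δ.1 ∧
      ∀ δ' : MixedStrategy P, G.Deterrent δ'.1 → G.expCost δ.1 ≤ G.expCost δ'.1 := by
  have hcl : IsClosed {δ : MixedStrategy P | G.Deterrent δ.1} := by
    simp only [Deterrent, Set.ofPred_forall]
    refine isClosed_iInter fun A => isClosed_le ?_ continuous_const
    unfold pay
    exact continuous_finsetSum _ fun d _ =>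
      continuous_const.mul ((continuous_apply d).comp continuous_subtype_val)
  have hc : Continuous fun δ : MixedStrategy P => G.expCost δ.1 := by
    unfold expCost
    exact continuous_finsetSum _ fun d _ =>
      continuous_const.mul ((continuous_apply d).comp continuous_subtype_val)
  have : CompactSpace (MixedStrategy P) := isCompact_iff_compactSpace.1 (isCompact_stdSimplex ℝ _)
  obtain ⟨δ, hδ, hmin⟩ := hcl.isCompact.exists_isMinOn hne hc.continuousOn
  exact ⟨δ, hδ, fun δ' h => hmin h⟩

/-- If guessing all the secrets in a random order does not pay, the uniform distribution is
deterrent. -/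
lemma exists_deterrent (G : CostlyGuessesGame P N)
    (h : G.γ < ((Fintype.card P : ℝ) + 1) * G.σ / 2) :
    ∃ δ : MixedStrategy P, G.Deterrent δ.1 := by
  have hn : (0 : ℝ) < Fintype.card P := by
    obtain ⟨p, -⟩ := G.E_nonempty 0
    exact_mod_cast Fintype.card_pos_iff.2 ⟨p⟩
  have h1 : ∑ _p : P, (Fintype.card P : ℝ)⁻¹ = 1 := by
    rw [Finset.sum_const, Finset.card_univ, nsmul_eq_mul, mul_inv_cancel₀ hn.ne']
  refine ⟨⟨fun _ => (Fintype.card P : ℝ)⁻¹, fun _ => inv_nonneg.2 hn.le, h1⟩, fun A => ?_⟩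
  change G.pay (fun _ => (Fintype.card P : ℝ)⁻¹) A ≤ 0
  have hrev := G.seqPay_add_reverse (fun _ => (Fintype.card P : ℝ)⁻¹) 1 A.1
  -- Under a constant mass the order is irrelevant, so the list and its reverse each earn the mean
  -- payoff.
  have heq : G.seqPay (fun _ => (Fintype.card P : ℝ)⁻¹) 1 A.1.reverse
      = G.seqPay (fun _ => (Fintype.card P : ℝ)⁻¹) 1 A.1 := by
    rw [seqPay_eq_sum, seqPay_eq_sum]
    simp
  rw [heq, List.map_const', List.sum_replicate, nsmul_eq_mul] at hrev
  rw [pay_eq_seqPay, h1]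
  have hk : (A.1.length : ℝ) ≤ Fintype.card P := by exact_mod_cast A.2.length_le_card
  have hk0 : (0 : ℝ) ≤ A.1.length := Nat.cast_nonneg _
  have hfac : G.γ * (A.1.length * (Fintype.card P : ℝ)⁻¹)
      - G.σ * (A.1.length * 1 - ((A.1.length : ℝ) - 1) / 2 * (A.1.length * (Fintype.card P : ℝ)⁻¹))
      = A.1.length * (Fintype.card P : ℝ)⁻¹
        * (G.γ - G.σ * (Fintype.card P - ((A.1.length : ℝ) - 1) / 2)) := by
    field_simp
  -- The bracket grows with the number of guesses, so the worst case is guessing all secrets, where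
  -- it equals `γ - (|P| + 1) σ / 2`.
  have hneg : G.γ - G.σ * (Fintype.card P - ((A.1.length : ℝ) - 1) / 2) ≤ 0 := by
    nlinarith [mul_nonneg G.σ_pos.le (sub_nonneg.2 hk)]
  have := mul_nonpos_of_nonneg_of_nonpos (mul_nonneg hk0 (inv_nonneg.2 hn.le)) hneg
  linarith

end

end CostlyGuessesGame

/-! ### The main theorem -/

theorem proposition5 {P : Type*} [Fintype P] [DecidableEq P] {N : ℕ} [NeZero N]
    (G : CostlyGuessesGame P N) (hγσ : G.σ < G.γ) :
    (G.γ < ((Fintype.card P : ℝ) + 1) * G.σ / 2 →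
      (∃ ν, G.LPFeasible ν) ∧ (∃ ν, G.IsLPSolution ν) ∧
      ∀ ν, G.IsLPSolution ν →
        (-G.C 0 - G.lam < G.lpObjective ν →
          (∃ δ : MixedStrategy P,
            (∀ i, ∀ p ∈ G.E i, δ.1 p = ν i / ((G.E i).card : ℝ)) ∧ G.IsSSEStrategy δ) ∧
          ∀ δ br, G.IsSSE δ br → G.expUD δ (br δ) = G.lpObjective ν) ∧
        (G.lpObjective ν < -G.C 0 - G.lam → G.CheapestIsTheSSE)) ∧
    (((Fintype.card P : ℝ) + 1) * G.σ / 2 < G.γ → G.CheapestIsTheSSE) := by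
  refine ⟨fun h => ?_, fun h => CostlyGuessesGame.cheapestIsTheSSE_of_deterrent_lt fun δ hδ =>
    absurd hδ (G.not_deterrent h δ)⟩
  obtain ⟨δ₀, hdet, hopt⟩ := CostlyGuessesGame.exists_optimal_deterrent (G.exists_deterrent h)
  have hfeas : G.LPFeasible (G.classMass δ₀.1) :=
    hdet.lpFeasible fun i j hij p hp q hq => hdet.mono_of_optimal hopt hij hp hq
  have hsol : G.IsLPSolution (G.classMass δ₀.1) := ⟨hfeas, fun ν' hν' => by
    obtain ⟨δ', -, hd', hc'⟩ := hν'.exists_mixedStrategy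
    rw [← hc', CostlyGuessesGame.lpObjective_classMass]
    exact neg_le_neg (hopt δ' hd')⟩
  refine ⟨⟨_, hfeas⟩, ⟨_, hsol⟩, fun ν hν => ?_⟩
  -- The value of the program bounds every deterrent distribution, not only those constant on
  -- classes, since the class masses of a globally optimal one are feasible.
  have hD : ∀ δ : MixedStrategy P, G.Deterrent δ.1 → -G.expCost δ.1 ≤ G.lpObjective ν := by
    intro δ hδ
    refine (neg_le_neg (hopt δ hδ)).trans ?_
    rw [← CostlyGuessesGame.lpObjective_classMass]
    exact hν.optimal _ hfeas
  obtain ⟨δ, hcl, hd, hc⟩ := hν.feasible.exists_mixedStrategy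
  refine ⟨fun hlt => ?_, fun hlt => CostlyGuessesGame.cheapestIsTheSSE_of_deterrent_lt fun δ' hδ' =>
    (hD δ' hδ').trans_lt hlt⟩
  obtain ⟨h1, h2⟩ := CostlyGuessesGame.sse_of_optimal_deterrent hD hlt.le hd hc
  exact ⟨⟨δ, hcl, h1⟩, h2⟩
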